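/- Lemma 2 (Optimal guard zone radius). A transmitter at the origin of $\mathbb{R}^2$ sends with power $P_t>0$ to a receiver at distance $d>0$. The eavesdroppers form a homogeneous Poisson point process $\Phi_e\subset\mathbb{R}^2$ of density $\lambda_e>0$. The fading variables $h$ (transmitter to receiver) and $g_y$ (transmitter to eavesdropper $y\in\Phi_e$) are $\exp(1)$-distributed, independent of one another and of $\Phi_e$. The path-loss exponent is $\alpha>2$, and the noise powers at the receiver and at the eavesdroppers are $\sigma_P^2,\sigma_S^2>0$. For a guard zone radius $r_g\ge 0$ the transmitter is active, $\delta_a=1$, if and only if no eavesdropper lies in the disc $\mathcal{B}(o,r_g)$ of radius $r_g$ around the origin. With $\mathrm{SNR}_P=P_t h d^{-\alpha}/\sigma_P^2$, with $\mathrm{SNR}_S=P_t g_{y^*}\|y^*\|^{-\alpha}/\sigma_S^2$, where $y^*=\arg\max_{y\in\Phi_e} g_y\|y\|^{-\alpha}$ is the strongest eavesdropper, and with thresholds $\beta_t,\beta_e>0$, put $$P_{\rm cov}^{GZ}(r_g)=\mathbb{P}(\mathrm{SNR}_P\ge\beta_t,\ \delta_a=1),\qquad P_{\rm sec}^{GZ}(r_g)=\mathbb{P}(\mathrm{SNR}_S\le\beta_e\mid\delta_a=1).$$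 Let $0<\epsilon<1$. Then there is exactly one radius $r_g^*\ge 0$ that maximizes $P_{\rm cov}^{GZ}(r_g)$ over all $r_g\ge 0$ with $P_{\rm sec}^{GZ}(r_g)\ge\epsilon$, and a number $r_g^*\ge 0$ is this radius if and only if $$\Gamma\left(\frac{2}{\alpha},\frac{(r_g^*)^{\alpha}\beta_e\sigma_S^2}{P_t}\right)=\min\left\{\frac{\alpha\log\left(\frac{1}{\epsilon}\right)}{2\pi\lambda_{e}\left(\frac{P_{t}}{\sigma_S^2\beta_e}\right)^{\frac{2}{\alpha}}},\ \Gamma\left(\frac{2}{\alpha}\right)\right\},$$ where $\Gamma(s,x)=\int_x^\infty t^{s-1}e^{-t}\,dt$ is the upper incomplete gamma function and $\Gamma(s)=\Gamma(s,0)$. -/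

import Mathlib

open MeasureTheory ProbabilityTheory

noncomputable section

namespace GuardZone

/-- The Euclidean plane. -/
abbrev Plane : Type := EuclideanSpace ℝ (Fin 2)

variable {Ω : Type*}

/-- `count Y B ω` is the number `N(B)` of points of the random point pattern `(Y i ω)` that lie in
`B` (possibly infinite). -/
def count (Y : ℕ → Ω → Plane) (B : Set Plane) (ω : Ω) : ℕ∞ := {i : ℕ | Y i ω ∈ B}.encard

/-- `(Y i)` enumerates the points of a homogeneous Poisson point process of density `lam > 0` in the
plane: the number of points in a Borel set of finite area `a` is Poisson with mean `lam * a`, and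
the numbers of points in pairwise disjoint Borel sets are independent.  Since `lam > 0`, the process
has almost surely infinitely many points, so that `ℕ` is the right index set, and almost surely no
two of them coincide. -/
structure IsPoissonPointProcess [MeasurableSpace Ω] (Y : ℕ → Ω → Plane) (lam : ℝ)
    (μ : Measure Ω) : Prop where
  measurable : ∀ i, Measurable (Y i)
  count_law : ∀ B : Set Plane, MeasurableSet B → volume B ≠ ⊤ → ∀ k : ℕ,
    μ {ω | count Y B ω = k} =
      ENNReal.ofReal (Real.exp (-(lam * volume.real B)) * (lam * volume.real B) ^ k
        / (k.factorial : ℝ))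
  indep : ∀ (n : ℕ) (B : Fin n → Set Plane), (∀ k, MeasurableSet (B k)) →
    Pairwise (fun k l => Disjoint (B k) (B l)) → iIndepFun (fun k => count Y (B k)) μ

/-- The event `δ_a = 1`: the transmitter at the origin is active, i.e. there is no eavesdropper in
the guard zone of radius `r` around it. -/
def active (Y : ℕ → Ω → Plane) (r : ℝ) : Set Ω := {ω | count Y (Metric.ball 0 r) ω = 0}

/-- The gain `g_y ‖y‖^(-α)` between the transmitter and the `i`-th eavesdropper. -/
def gain (α : ℝ) (Y : ℕ → Ω → Plane) (g : ℕ → Ω → ℝ) (ω : Ω) (i : ℕ) : ℝ :=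
  g i ω * ‖Y i ω‖ ^ (-α)

/-- The index of a strongest eavesdropper `y*`: an index at which the gain is maximal.  Such an
index exists almost surely when `α > 2`; where there is none, the index is arbitrary. -/
def strongest (α : ℝ) (Y : ℕ → Ω → Plane) (g : ℕ → Ω → ℝ) (ω : Ω) : ℕ :=
  Classical.epsilon fun i => ∀ j, gain α Y g ω j ≤ gain α Y g ω i

/-- The SNR at the strongest eavesdropper. -/
def snrS (α Pt σS : ℝ) (Y : ℕ → Ω → Plane) (g : ℕ → Ω → ℝ) (ω : Ω) : ℝ :=
  Pt * gain α Y g ω (strongest α Y g ω) / σS ^ 2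

/-- The SNR at the primary receiver, at distance `d` from the transmitter. -/
def snrP (α Pt σP d : ℝ) (h : Ω → ℝ) (ω : Ω) : ℝ := Pt * h ω * d ^ (-α) / σP ^ 2

/-- Coverage probability `ℙ(SNR_P ≥ βt, δ_a = 1)` with a guard zone of radius `r`. -/
def Pcov [MeasurableSpace Ω] (μ : Measure Ω) (α Pt σP d βt : ℝ) (Y : ℕ → Ω → Plane) (h : Ω → ℝ)
    (r : ℝ) : ℝ :=
  μ.real ({ω | βt ≤ snrP α Pt σP d h ω} ∩ active Y r)

/-- Secure communication probability `ℙ(SNR_S ≤ βe | δ_a = 1)` with a guard zone of radius `r`. -/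
def Psec [MeasurableSpace Ω] (μ : Measure Ω) (α Pt σS βe : ℝ) (Y : ℕ → Ω → Plane)
    (g : ℕ → Ω → ℝ) (r : ℝ) : ℝ :=
  (ProbabilityTheory.cond μ (active Y r)).real {ω | snrS α Pt σS Y g ω ≤ βe}

/-- The radius `r` is optimal: it is admissible (`r ≥ 0` and `Psec r ≥ ε`) and maximizes the
coverage probability among all admissible radii. -/
def IsOptimalRadius (Pcov Psec : ℝ → ℝ) (ε r : ℝ) : Prop :=
  r ∈ {r' : ℝ | 0 ≤ r' ∧ ε ≤ Psec r'} ∧ IsMaxOn Pcov {r' : ℝ | 0 ≤ r' ∧ ε ≤ Psec r'} r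

/-- The upper incomplete gamma function `Γ(s, x)`. -/
def upperGamma (s x : ℝ) : ℝ := ∫ t in Set.Ioi x, t ^ (s - 1) * Real.exp (-t)

end GuardZone

end

/-! Write `T = βe σS² / Pt`. Almost surely a strongest eavesdropper exists, and then `SNR_S ≤ βe`
says that every gain is at most `T`. Jointly with `δ_a = 1` it says that every marked point `(y,
g_y)` lies in one set `D`. Integrating out the independent marks leaves the expectation of a product
`∏ f(y)` over the points, with `f(y)` the mark probability of the section of `D` at `y`. The
generating functional gives `exp(-λ ∫ (1 - f))`. The disc contributes `π r²` to that integral, which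
cancels on conditioning, and the exterior contributes a radial integral that is an incomplete gamma
value (`IsPoissonPointProcess.Psec_eq`).

So the constraint reads `Γ(2/α, T r^α) ≤ c`, whose left side strictly decreases in `r`, while the
coverage probability is a constant times `exp(-λ π r²)`. The smallest admissible radius is therefore
the unique optimum (`isOptimalRadius_iff`): the constraint is tight there, or holds already at `r =
0`, which is what the minimum with `Γ(2/α)` encodes. -/

namespace GuardZone

open scoped ENNReal

/-! ### Counts of a Poisson process and its intensity measure. -/

section PointProcess

variable {Ω : Type*}

lemma coe_count (Y : ℕ → Ω → Plane) (B : Set Plane) (ω : Ω) :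
    (count Y B ω : ℝ≥0∞) = ∑' i, (Y i ⁻¹' B).indicator 1 ω := by
  rw [count, ← ENNReal.tsum_set_one, tsum_subtype {i | Y i ω ∈ B} (fun _ => (1 : ℝ≥0∞))]
  exact tsum_congr fun i => rfl

variable [MeasurableSpace Ω] {μ : Measure Ω} {Y : ℕ → Ω → Plane} {lam : ℝ}

lemma measurable_count (hY : ∀ i, Measurable (Y i)) {B : Set Plane} (hB : MeasurableSet B) :
    Measurable (count Y B) := by
  have h : Measurable fun ω => (count Y B ω : ℝ≥0∞) := by
    simp_rw [coe_count]
    exact Measurable.tsum fun i => measurable_one.indicator (hY i hB)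
  refine measurable_to_countable' fun k => ?_
  convert h (measurableSet_singleton (k : ℝ≥0∞)) using 1
  ext ω
  simp

lemma lintegral_count (hY : ∀ i, Measurable (Y i)) {B : Set Plane} (hB : MeasurableSet B) :
    ∫⁻ ω, count Y B ω ∂μ = Measure.sum (fun i => μ.map (Y i)) B := by
  simp_rw [coe_count]
  rw [lintegral_tsum fun i => (measurable_one.indicator (hY i hB)).aemeasurable,
    Measure.sum_apply _ hB]
  refine tsum_congr fun i => ?_
  rw [lintegral_indicator_one (hY i hB), Measure.map_apply (hY i) hB]

/-- The generating function of the Poisson weights. -/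
lemma hasSum_poisson_mul_pow (a q : ℝ) :
    HasSum (fun k : ℕ => Real.exp (-a) * a ^ k / (k.factorial : ℝ) * q ^ k)
      (Real.exp (-(a * (1 - q)))) := by
  have h := (NormedSpace.expSeries_div_hasSum_exp (a * q)).mul_left (Real.exp (-a))
  rw [← Real.exp_eq_exp_ℝ, ← Real.exp_add] at h
  have e : -(a * (1 - q)) = -a + a * q := by ring
  rw [e]
  refine Eq.mp (congrArg (fun f => HasSum f _) (funext fun k => ?_)) h
  rw [mul_pow]
  ring

lemma hasSum_poisson_mean (a : ℝ) :
    HasSum (fun k : ℕ => Real.exp (-a) * a ^ k / (k.factorial : ℝ) * k) a := by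
  have h := (NormedSpace.expSeries_div_hasSum_exp a).mul_left (Real.exp (-a) * a)
  rw [← Real.exp_eq_exp_ℝ, mul_right_comm, ← Real.exp_add, neg_add_cancel, Real.exp_zero,
    one_mul] at h
  refine (hasSum_nat_add_iff' 1).1 ?_
  simp only [Finset.range_one, Finset.sum_singleton, Nat.cast_zero, mul_zero, sub_zero]
  refine Eq.mp (congrArg (fun f => HasSum f _) (funext fun k => ?_)) h
  rw [Nat.factorial_succ]
  push_cast
  field_simp
  ring

lemma poisson_nonneg {a : ℝ} (ha : 0 ≤ a) (k : ℕ) :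
    0 ≤ Real.exp (-a) * a ^ k / (k.factorial : ℝ) := by positivity

variable (hY : IsPoissonPointProcess Y lam μ) (hlam : 0 < lam)

include hY hlam

/-- Expectations of functions of the number of points in a set of finite area. -/
lemma IsPoissonPointProcess.lintegral_comp_count [IsProbabilityMeasure μ] {B : Set Plane}
    (hB : MeasurableSet B) (hfin : volume B ≠ ⊤) (F : ℕ∞ → ℝ≥0∞) :
    (∀ᵐ ω ∂μ, count Y B ω ≠ ⊤) ∧
    ∫⁻ ω, F (count Y B ω) ∂μ =
      ∑' k : ℕ, ENNReal.ofReal (Real.exp (-(lam * volume.real B)) * (lam * volume.real B) ^ k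
        / (k.factorial : ℝ)) * F k := by
  have hm := measurable_count hY.measurable hB
  have ha : 0 ≤ lam * volume.real B := by positivity
  have hmeas : ∀ k : ℕ, MeasurableSet {ω | count Y B ω = k} := fun k =>
    hm (MeasurableSet.of_discrete (s := {(k : ℕ∞)}))
  have hdisj : Pairwise (Function.onFun Disjoint fun k : ℕ => {ω | count Y B ω = k}) := by
    intro k l hkl
    refine Set.disjoint_left.2 fun ω h₁ h₂ => hkl ?_
    simp only [Set.mem_ofPred_eq] at h₁ h₂
    exact_mod_cast h₁.symm.trans h₂
  -- The Poisson weights sum to `1` (generating function at `q = 1`), so no mass is left for the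
  -- value `⊤`.
  have htop : ∀ᵐ ω ∂μ, count Y B ω ≠ ⊤ := by
    have h1 : μ (⋃ k : ℕ, {ω | count Y B ω = k}) = 1 := by
      rw [measure_iUnion hdisj hmeas]
      simp_rw [hY.count_law B hB hfin]
      have hs := hasSum_poisson_mul_pow (lam * volume.real B) 1
      simp only [one_pow, mul_one, sub_self, mul_zero, neg_zero, Real.exp_zero] at hs
      rw [← ENNReal.ofReal_tsum_of_nonneg (poisson_nonneg ha) hs.summable, hs.tsum_eq,
        ENNReal.ofReal_one]
    have h2 := (prob_compl_eq_zero_iff (MeasurableSet.iUnion hmeas)).2 h1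
    filter_upwards [compl_mem_ae_iff.2 h2] with ω hω ht
    simp only [compl_compl, Set.mem_iUnion, Set.mem_ofPred_eq] at hω
    obtain ⟨k, hk⟩ := hω
    exact ENat.natCast_ne_top k (hk.symm.trans ht)
  refine ⟨htop, ?_⟩
  have h : ∀ᵐ ω ∂μ, F (count Y B ω) =
      ∑' k : ℕ, {ω | count Y B ω = k}.indicator (fun _ => F k) ω := by
    filter_upwards [htop] with ω hω
    obtain ⟨n, hn⟩ := ENat.ne_top_iff_exists.1 hω
    rw [tsum_eq_single n]
    · simp [← hn]
    · intro k hk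
      rw [Set.indicator_of_notMem]
      simp only [Set.mem_ofPred_eq, ← hn]
      exact_mod_cast hk.symm
  rw [lintegral_congr_ae h,
    lintegral_tsum fun k => (measurable_const.indicator (hmeas k)).aemeasurable]
  refine tsum_congr fun k => ?_
  rw [lintegral_indicator_const (hmeas k), hY.count_law B hB hfin, mul_comm]

/-- The probability generating function of the number of points. -/
lemma IsPoissonPointProcess.lintegral_pow_count [IsProbabilityMeasure μ] {B : Set Plane}
    (hB : MeasurableSet B) (hfin : volume B ≠ ⊤) {q : ℝ} (hq : 0 ≤ q) :
    ∫⁻ ω, ENNReal.ofReal q ^ (count Y B ω).toNat ∂μ =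
      ENNReal.ofReal (Real.exp (-(lam * volume.real B * (1 - q)))) := by
  have ha : 0 ≤ lam * volume.real B := by positivity
  rw [(hY.lintegral_comp_count hlam hB hfin fun n => ENNReal.ofReal q ^ n.toNat).2]
  have hs := hasSum_poisson_mul_pow (lam * volume.real B) q
  rw [← hs.tsum_eq, ENNReal.ofReal_tsum_of_nonneg
    (fun k => mul_nonneg (poisson_nonneg ha k) (by positivity)) hs.summable]
  refine tsum_congr fun k => ?_
  rw [ENNReal.ofReal_mul (poisson_nonneg ha k), ENNReal.ofReal_pow hq, ENat.toNat_natCast]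

lemma IsPoissonPointProcess.sum_map_apply [IsProbabilityMeasure μ] {B : Set Plane}
    (hB : MeasurableSet B) (hfin : volume B ≠ ⊤) :
    Measure.sum (fun i => μ.map (Y i)) B = ENNReal.ofReal lam * volume B := by
  have ha : 0 ≤ lam * volume.real B := by positivity
  rw [← lintegral_count hY.measurable hB,
    (hY.lintegral_comp_count hlam hB hfin fun n => (n : ℝ≥0∞)).2]
  have hs := hasSum_poisson_mean (lam * volume.real B)
  have : ENNReal.ofReal lam * volume B = ENNReal.ofReal (lam * volume.real B) := by
    rw [ENNReal.ofReal_mul hlam.le, Measure.real, ENNReal.ofReal_toReal hfin]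
  rw [this]
  conv_rhs => rw [← hs.tsum_eq, ENNReal.ofReal_tsum_of_nonneg
    (fun k => mul_nonneg (poisson_nonneg ha k) (by positivity)) hs.summable]
  refine tsum_congr fun k => ?_
  rw [ENNReal.ofReal_mul (poisson_nonneg ha k), ENNReal.ofReal_natCast]
  simp

/-- Campbell's formula: the intensity measure is a multiple of Lebesgue measure. -/
lemma IsPoissonPointProcess.sum_map [IsProbabilityMeasure μ] :
    Measure.sum (fun i => μ.map (Y i)) = ENNReal.ofReal lam • (volume : Measure Plane) := by
  ext B hB
  -- The count law covers only sets of finite area, so `B` is exhausted by its bounded parts.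
  have hmono : Monotone fun n : ℕ => B ∩ Metric.ball (0 : Plane) n := fun m n hmn =>
    Set.inter_subset_inter_right _ (Metric.ball_subset_ball (by exact_mod_cast hmn))
  have hU : ⋃ n : ℕ, B ∩ Metric.ball (0 : Plane) n = B := by
    rw [← Set.inter_iUnion, Metric.iUnion_ball_nat, Set.inter_univ]
  rw [← hU, hmono.measure_iUnion, hmono.measure_iUnion]
  refine iSup_congr fun n => ?_
  rw [hY.sum_map_apply hlam (hB.inter Metric.isOpen_ball.measurableSet), Measure.smul_apply,
    smul_eq_mul]
  exact measure_ne_top_of_subset Set.inter_subset_right (measure_ball_lt_top.ne)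

end PointProcess

/-! ### The probability generating functional. -/

section GeneratingFunctional

variable {Ω : Type*}

/-- A product over the points of a pattern of a simple function that differs from `1` at finitely
many of them only. -/
lemma iInf_prod_one_sub_simpleFunc (Y : ℕ → Ω → Plane) (s : SimpleFunc Plane ℝ≥0∞) (ω : Ω)
    (hω : ∀ c ∈ s.range.filter (· ≠ 0), count Y (s ⁻¹' {c}) ω ≠ ⊤) :
    ⨅ m : ℕ, ∏ i ∈ Finset.range m, (1 - s (Y i ω)) =
      ∏ c ∈ s.range.filter (· ≠ 0), (1 - c) ^ (count Y (s ⁻¹' {c}) ω).toNat := by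
  have hJ : {i | s (Y i ω) ≠ 0}.Finite := by
    have : {i | s (Y i ω) ≠ 0} ⊆
        ⋃ c ∈ s.range.filter (· ≠ 0), {i | Y i ω ∈ s ⁻¹' {c}} := by
      intro i hi
      simp only [Set.mem_iUnion]
      exact ⟨s (Y i ω), Finset.mem_filter.2 ⟨s.mem_range_self _, hi⟩, rfl⟩
    refine Set.Finite.subset (Set.Finite.biUnion (Finset.finite_toSet _) fun c hc => ?_) this
    exact Set.encard_ne_top_iff.1 (hω c hc)
  -- All factors are at most `1`, so partial products decrease; they stabilize once the finitely
  -- many factors different from `1` are included.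
  have hprod : ⨅ m : ℕ, ∏ i ∈ Finset.range m, (1 - s (Y i ω)) =
      ∏ i ∈ hJ.toFinset, (1 - s (Y i ω)) := by
    refine le_antisymm ?_ (le_iInf fun m => ?_)
    · obtain ⟨M, hM⟩ := hJ.toFinset.exists_nat_subset_range
      refine (iInf_le _ M).trans (le_of_eq (Finset.prod_subset hM fun i _ hi => ?_).symm)
      have : s (Y i ω) = 0 := by simpa using hi
      rw [this, tsub_zero]
    · rw [← Finset.prod_filter_mul_prod_filter_not (Finset.range m) (fun i => s (Y i ω) ≠ 0)]
      have h1 : ∏ i ∈ Finset.range m with ¬s (Y i ω) ≠ 0, (1 - s (Y i ω)) = 1 := by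
        refine Finset.prod_eq_one fun i hi => ?_
        have := (Finset.mem_filter.1 hi).2
        rw [not_not.1 this, tsub_zero]
      rw [h1, mul_one]
      refine Finset.prod_le_prod_of_subset_of_le_one' (fun i hi => ?_) fun i _ _ => tsub_le_self
      simpa using (Finset.mem_filter.1 hi).2
  rw [hprod, ← Finset.prod_fiberwise_of_maps_to (t := s.range.filter (· ≠ 0))
    (g := fun i => s (Y i ω)) fun i hi => Finset.mem_filter.2
      ⟨s.mem_range_self _, by simpa using hi⟩]
  refine Finset.prod_congr rfl fun c hc => ?_
  have hcard : (count Y (s ⁻¹' {c}) ω).toNat =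
      (hJ.toFinset.filter fun i => s (Y i ω) = c).card := by
    have : {i | Y i ω ∈ s ⁻¹' {c}} =
        ((hJ.toFinset.filter fun i => s (Y i ω) = c : Finset ℕ) : Set ℕ) := by
      ext i
      have := (Finset.mem_filter.1 hc).2
      simp only [Set.mem_preimage, Set.mem_singleton_iff, Set.mem_ofPred_eq, Finset.coe_filter,
        Set.Finite.mem_toFinset]
      exact ⟨fun h => ⟨h ▸ this, h⟩, fun h => h.2⟩
    rw [count, this, Set.encard_coe_eq_coe_finsetCard, ENat.toNat_natCast]
  rw [hcard, Finset.prod_congr rfl (g := fun _ => 1 - c), Finset.prod_const]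
  intro i hi
  rw [(Finset.mem_filter.1 hi).2]

variable [MeasurableSpace Ω] {μ : Measure Ω} [IsProbabilityMeasure μ] {Y : ℕ → Ω → Plane}
  {lam : ℝ}

/-- The fibres of the nonzero values are disjoint and of finite area, so their counts are
independent Poisson variables and the expectation factors into generating functions at `q = 1 - c`.
The exponents add up to the integral of `s`. The value `0` is left out: its fibre has infinite area
but contributes only factors `1`. -/
lemma IsPoissonPointProcess.lintegral_iInf_prod_simpleFunc
    (hY : IsPoissonPointProcess Y lam μ) (hlam : 0 < lam) (s : SimpleFunc Plane ℝ≥0∞)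
    (hs : ∀ y, s y ≤ 1) (hfin : ∫⁻ y, s y ≠ ⊤) :
    ∫⁻ ω, ⨅ m : ℕ, ∏ i ∈ Finset.range m, (1 - s (Y i ω)) ∂μ =
      ENNReal.ofReal (Real.exp (-(lam * (∫⁻ y, s y).toReal))) := by
  have hc1 : ∀ c ∈ s.range, c ≤ 1 := by
    intro c hc
    obtain ⟨y, rfl⟩ := SimpleFunc.mem_range.1 hc
    exact hs y
  have hcv : ∀ c ∈ s.range.filter (· ≠ 0), volume (s ⁻¹' {c}) ≠ ⊤ := by
    intro c hc h
    rw [SimpleFunc.lintegral_eq_lintegral, SimpleFunc.lintegral] at hfin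
    have := ENNReal.sum_ne_top.1 hfin c (Finset.mem_filter.1 hc).1
    rw [h, ENNReal.mul_top (Finset.mem_filter.1 hc).2] at this
    exact this rfl
  have hae : ∀ᵐ ω ∂μ, ∀ c ∈ s.range.filter (· ≠ 0), count Y (s ⁻¹' {c}) ω ≠ ⊤ :=
    (ae_ball_iff (Finset.countable_toSet _)).2 fun c hc =>
      (hY.lintegral_comp_count hlam (s.measurableSet_fiber c) (hcv c hc) fun _ => 0).1
  rw [lintegral_congr_ae (hae.mono fun ω hω => iInf_prod_one_sub_simpleFunc Y s ω hω)]
  have hind : iIndepFun (fun c : {c // c ∈ s.range.filter (· ≠ 0)} =>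
      count Y (s ⁻¹' {(c : ℝ≥0∞)})) μ := by
    have e := (s.range.filter (· ≠ 0)).equivFin
    have := hY.indep _ (fun k => s ⁻¹' {((e.symm k : _) : ℝ≥0∞)})
      (fun k => s.measurableSet_fiber _) fun k l hkl => by
        refine Disjoint.preimage _ (Set.disjoint_singleton.2 fun h => hkl ?_)
        exact e.symm.injective (Subtype.ext h)
    simpa using this.precomp e.injective
  have hind' := hind.comp
    (fun c (n : ℕ∞) => (1 - (c : ℝ≥0∞)) ^ n.toNat) fun c => Measurable.of_discrete
  have hprod := lintegral_prod_eq_prod_lintegral_of_indepFun Finset.univ _ hind' fun c =>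
    Measurable.of_discrete.comp (measurable_count hY.measurable (s.measurableSet_fiber _))
  simp_rw [← Finset.prod_coe_sort (s.range.filter (· ≠ 0))]
  refine hprod.trans ?_
  have hfac : ∀ c : {c // c ∈ s.range.filter (· ≠ 0)},
      ∫⁻ ω, (1 - (c : ℝ≥0∞)) ^ (count Y (s ⁻¹' {(c : ℝ≥0∞)}) ω).toNat ∂μ =
        ENNReal.ofReal (Real.exp (-(lam * (c * volume (s ⁻¹' {(c : ℝ≥0∞)})).toReal))) := by
    intro c
    have hc := hc1 c (Finset.mem_filter.1 c.2).1
    have hct : (c : ℝ≥0∞) ≠ ⊤ := ne_top_of_le_ne_top ENNReal.one_ne_top hc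
    have hq : 1 - (c : ℝ≥0∞) = ENNReal.ofReal (1 - (c : ℝ≥0∞).toReal) := by
      rw [ENNReal.ofReal_sub _ ENNReal.toReal_nonneg, ENNReal.ofReal_one,
        ENNReal.ofReal_toReal hct]
    have hq0 : 0 ≤ 1 - (c : ℝ≥0∞).toReal :=
      sub_nonneg.2 (ENNReal.toReal_mono ENNReal.one_ne_top hc)
    rw [hq, hY.lintegral_pow_count hlam (s.measurableSet_fiber _) (hcv c c.2) hq0,
      ENNReal.toReal_mul, Measure.real]
    ring_nf
  refine (Finset.prod_congr rfl fun c _ => hfac c).trans ?_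
  rw [← ENNReal.ofReal_prod_of_nonneg fun _ _ => (Real.exp_pos _).le, ← Real.exp_sum,
    Finset.sum_neg_distrib, ← Finset.mul_sum,
    Finset.sum_coe_sort _ (fun c : ℝ≥0∞ => (c * volume (s ⁻¹' {c})).toReal),
    SimpleFunc.lintegral_eq_lintegral, SimpleFunc.lintegral, ← ENNReal.toReal_sum fun c hc =>
      ENNReal.mul_ne_top (ne_top_of_le_ne_top ENNReal.one_ne_top
        (hc1 c (Finset.mem_filter.1 hc).1)) (hcv c hc)]
  congr 5
  refine Finset.sum_filter_of_ne fun c _ hc h => hc ?_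
  rw [h, zero_mul]

/-- The probability generating functional of the Poisson point process. -/
lemma IsPoissonPointProcess.lintegral_iInf_prod
    (hY : IsPoissonPointProcess Y lam μ) (hlam : 0 < lam) {f : Plane → ℝ≥0∞}
    (hf : Measurable f) (hf1 : ∀ y, f y ≤ 1) (hfin : ∫⁻ y, (1 - f y) ≠ ⊤) :
    ∫⁻ ω, ⨅ m : ℕ, ∏ i ∈ Finset.range m, f (Y i ω) ∂μ =
      ENNReal.ofReal (Real.exp (-(lam * (∫⁻ y, (1 - f y)).toReal))) := by
  have hg : Measurable fun y => 1 - f y := measurable_const.sub hf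
  let s := SimpleFunc.eapprox fun y => 1 - f y
  have hsup : ∀ y, ⨆ n, s n y = 1 - f y := SimpleFunc.iSup_eapprox_apply hg
  have hmono : Monotone s := SimpleFunc.monotone_eapprox _
  have hs_le : ∀ n y, s n y ≤ 1 - f y := fun n y => (hsup y) ▸ le_iSup (fun n => s n y) n
  have hanti : Antitone fun n y => 1 - s n y :=
    fun m n hmn y => tsub_le_tsub_left (hmono hmn y) 1
  have hlim : ∀ y, Filter.Tendsto (fun n => 1 - s n y) Filter.atTop (nhds (f y)) := by
    intro y
    have h := tendsto_atTop_iInf (f := fun n => 1 - s n y) fun m n hmn => hanti hmn y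
    rwa [← ENNReal.sub_iSup ENNReal.one_ne_top, hsup, ENNReal.sub_sub_cancel ENNReal.one_ne_top
      (hf1 y)] at h
  have hpt : ∀ ω (m : ℕ), ∏ i ∈ Finset.range m, f (Y i ω) =
      ⨅ n, ∏ i ∈ Finset.range m, (1 - s n (Y i ω)) := by
    intro ω m
    refine tendsto_nhds_unique (ENNReal.tendsto_finsetProd_of_ne_top _
      (fun i _ => hlim (Y i ω)) fun i _ => ne_top_of_le_ne_top ENNReal.one_ne_top (hf1 _)) ?_
    exact tendsto_atTop_iInf fun a b hab => Finset.prod_le_prod' fun i _ => hanti hab _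
  -- With infinite products written as infima, the approximation limit and the product limit
  -- commute, and monotone convergence applies.
  have hswap : ∀ ω, ⨅ m : ℕ, ∏ i ∈ Finset.range m, f (Y i ω) =
      ⨅ n, ⨅ m : ℕ, ∏ i ∈ Finset.range m, (1 - s n (Y i ω)) := by
    intro ω
    simp_rw [hpt]
    exact iInf_comm
  have hmeas : ∀ n, Measurable fun ω => ⨅ m : ℕ, ∏ i ∈ Finset.range m, (1 - s n (Y i ω)) :=
    fun n => Measurable.iInf fun m => Finset.measurable_prod _ fun i _ =>
      measurable_const.sub ((s n).measurable.comp (hY.measurable i))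
  have hanti' : Antitone fun n ω => ⨅ m : ℕ, ∏ i ∈ Finset.range m, (1 - s n (Y i ω)) :=
    fun a b hab ω => iInf_mono fun m => Finset.prod_le_prod' fun i _ => hanti hab _
  have hsfin : ∀ n, ∫⁻ y, s n y ≠ ⊤ := fun n =>
    ne_top_of_le_ne_top hfin (lintegral_mono (hs_le n))
  have hval : ∀ n, ∫⁻ ω, ⨅ m : ℕ, ∏ i ∈ Finset.range m, (1 - s n (Y i ω)) ∂μ =
      ENNReal.ofReal (Real.exp (-(lam * (∫⁻ y, s n y).toReal))) := fun n =>
    hY.lintegral_iInf_prod_simpleFunc hlam (s n)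
      (fun y => (hs_le n y).trans tsub_le_self) (hsfin n)
  simp_rw [hswap]
  rw [lintegral_iInf hmeas hanti' (by rw [hval]; exact ENNReal.ofReal_ne_top)]
  simp_rw [hval]
  have hint : Filter.Tendsto (fun n => ∫⁻ y, s n y) Filter.atTop (nhds (∫⁻ y, (1 - f y))) := by
    have h := tendsto_atTop_iSup (f := fun n => ∫⁻ y, s n y)
      fun a b hab => lintegral_mono (hmono hab)
    rwa [← lintegral_iSup (fun n => (s n).measurable) (fun a b hab => hmono hab),
      lintegral_congr hsup] at h
  refine tendsto_nhds_unique (tendsto_atTop_iInf fun a b hab => ?_)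
    ((ENNReal.continuous_ofReal.tendsto _).comp ((Real.continuous_exp.tendsto _).comp
      (((ENNReal.tendsto_toReal hfin).comp hint).const_mul lam).neg))
  refine ENNReal.ofReal_le_ofReal (Real.exp_le_exp.2 (neg_le_neg
    (mul_le_mul_of_nonneg_left (ENNReal.toReal_mono (hsfin b) ?_) hlam.le)))
  exact lintegral_mono (hmono hab)

end GeneratingFunctional

/-! ### Radial integrals and the incomplete gamma function. -/

section Radial

lemma upperGamma_rpow_integral {α T r : ℝ} (hα : 0 < α) (hT : 0 < T) (hr : 0 ≤ r) :
    ∫ x in Set.Ioi r, x * Real.exp (-(T * x ^ α)) =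
      T ^ (-(2 / α)) / α * upperGamma (2 / α) (T * r ^ α) := by
  -- Substitution `u = x ^ α`: the exponent `2 / α - 1` is the one that turns the Jacobian `α x ^ (α
  -- - 1)` into a multiple of `x`.
  have h1 := integral_comp_rpow_Ioi_of_pos' (g := fun u : ℝ =>
    (T * u) ^ (2 / α - 1) * Real.exp (-(T * u))) hα (Real.rpow_nonneg hr α)
  rw [Real.rpow_rpow_inv hr hα.ne',
    integral_comp_mul_left_Ioi (fun t : ℝ => t ^ (2 / α - 1) * Real.exp (-t)) _ hT] at h1
  have h2 : ∀ x ∈ Set.Ioi r, (α * x ^ (α - 1)) •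
      ((T * x ^ α) ^ (2 / α - 1) * Real.exp (-(T * x ^ α))) =
      (α * T ^ (2 / α - 1)) * (x * Real.exp (-(T * x ^ α))) := by
    intro x hx
    have hx0 : 0 < x := hr.trans_lt hx
    have e : x ^ (α - 1) * (x ^ α) ^ (2 / α - 1) = x := by
      rw [← Real.rpow_mul hx0.le, ← Real.rpow_add hx0]
      have : α - 1 + α * (2 / α - 1) = 1 := by field_simp; ring
      rw [this, Real.rpow_one]
    rw [Real.mul_rpow hT.le (by positivity), smul_eq_mul]
    linear_combination α * T ^ (2 / α - 1) * Real.exp (-(T * x ^ α)) * e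
  rw [setIntegral_congr_fun measurableSet_Ioi h2, integral_const_mul] at h1
  have e2 : T ^ (-(2 / α)) = T⁻¹ * (T ^ (2 / α - 1))⁻¹ := by
    rw [← Real.rpow_neg hT.le, ← Real.rpow_neg_one, ← Real.rpow_add hT]
    congr 1
    ring
  have hTs : 0 < T ^ (2 / α - 1) := by positivity
  rw [e2, upperGamma]
  rw [smul_eq_mul] at h1
  field_simp
  field_simp at h1
  linarith

lemma lintegral_compl_ball_exp_neg_rpow {α T r : ℝ} (hα : 0 < α) (hT : 0 < T) (hr : 0 ≤ r) :
    ∫⁻ y in (Metric.ball (0 : Plane) r)ᶜ, ENNReal.ofReal (Real.exp (-(T * ‖y‖ ^ α))) =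
      ENNReal.ofReal (2 * Real.pi / α * T ^ (-(2 / α)) * upperGamma (2 / α) (T * r ^ α)) := by
  let F : ℝ → ℝ := (Set.Ici r).indicator fun x => Real.exp (-(T * x ^ α))
  have hF0 : ∀ x, 0 ≤ F x := fun x => Set.indicator_nonneg (fun _ _ => (Real.exp_pos _).le) _
  have hint : Integrable fun y : Plane => F ‖y‖ := by
    rw [integrable_fun_norm_addHaar]
    have h := (integrableOn_rpow_mul_exp_neg_mul_rpow (s := 1) (by norm_num) hα hT).indicator
      (measurableSet_Ici (a := r))
    refine h.congr (Filter.Eventually.of_forall fun x => ?_)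
    by_cases hx : x ∈ Set.Ici r <;> simp [F, hx]
  -- Polar coordinates: `2π` is the dimension times the area of the unit disc.
  have hI : ∫ y : Plane, F ‖y‖ = 2 * Real.pi *
      ∫ x in Set.Ioi r, x * Real.exp (-(T * x ^ α)) := by
    rw [integral_fun_norm_addHaar]
    have hb : (volume : Measure Plane).real (Metric.ball 0 1) = Real.pi := by
      rw [Measure.real, EuclideanSpace.volume_ball_fin_two]
      simp [Real.pi_pos.le]
    have hx : ∀ x : ℝ, x ^ (Module.finrank ℝ Plane - 1) • F x =
        (Set.Ici r).indicator (fun x => x * Real.exp (-(T * x ^ α))) x := by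
      intro x
      by_cases hx : x ∈ Set.Ici r <;> simp [F, hx]
    simp_rw [hx]
    rw [hb, setIntegral_indicator measurableSet_Ici, finrank_euclideanSpace_fin]
    have hs : (Set.Ioi 0 ∩ Set.Ici r : Set ℝ) =ᵐ[volume] Set.Ioi r := by
      have h1 : (Set.Ioi 0 ∩ Set.Ici r : Set ℝ) =ᵐ[volume] (Set.Ici 0 ∩ Set.Ici r : Set ℝ) :=
        Ioi_ae_eq_Ici.inter (ae_eq_refl _)
      rw [Set.Ici_inter_Ici, max_eq_right hr] at h1
      exact h1.trans Ioi_ae_eq_Ici.symm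
    rw [setIntegral_congr_set hs, smul_eq_mul, nsmul_eq_mul]
    push_cast
    ring
  rw [upperGamma_rpow_integral hα hT hr] at hI
  rw [← lintegral_indicator Metric.isOpen_ball.measurableSet.compl]
  have : 2 * Real.pi / α * T ^ (-(2 / α)) * upperGamma (2 / α) (T * r ^ α) =
      ∫ y : Plane, F ‖y‖ := by rw [hI]; ring
  rw [this, ofReal_integral_eq_lintegral_ofReal hint (Filter.Eventually.of_forall fun y => hF0 _)]
  refine lintegral_congr fun y => ?_
  by_cases hy : r ≤ ‖y‖ <;> simp [F, hy]

end Radial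

/-! ### Tails of the exponential law. -/

section Exponential

lemma expMeasure_one_Iic {x : ℝ} (hx : 0 ≤ x) :
    expMeasure 1 (Set.Iic x) = ENNReal.ofReal (1 - Real.exp (-x)) := by
  have := isProbabilityMeasure_expMeasure one_pos
  rw [← ofReal_cdf, cdf_expMeasure_eq one_pos, if_pos hx, one_mul]

lemma expMeasure_one_Ioi {x : ℝ} (hx : 0 ≤ x) :
    expMeasure 1 (Set.Ioi x) = ENNReal.ofReal (Real.exp (-x)) := by
  have := isProbabilityMeasure_expMeasure one_pos
  rw [← Set.compl_Iic, prob_compl_eq_one_sub measurableSet_Iic, expMeasure_one_Iic hx,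
    ← ENNReal.ofReal_one, ← ENNReal.ofReal_sub _ (by simpa using hx)]
  congr 1
  ring

lemma expMeasure_one_Ici {x : ℝ} (hx : 0 ≤ x) :
    expMeasure 1 (Set.Ici x) = ENNReal.ofReal (Real.exp (-x)) := by
  have hac : expMeasure 1 ≪ volume := withDensity_absolutelyContinuous _ _
  rw [← expMeasure_one_Ioi hx, measure_congr (hac.ae_eq Ioi_ae_eq_Ici)]

end Exponential

/-! ### Independent marking. -/

section Marking

variable {Ω E F : Type*} [MeasurableSpace Ω] [MeasurableSpace E] [MeasurableSpace F]
  {μ : Measure Ω} [IsProbabilityMeasure μ] {Y : ℕ → Ω → E} {g : ℕ → Ω → F} {ν : Measure F}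

/-- The probability that all points of an independently marked sequence lie in a given set. -/
lemma measure_forall_mem_marked (hY : ∀ i, Measurable (Y i)) (hg : ∀ i, Measurable (g i))
    (hlaw : ∀ i, μ.map (g i) = ν) (hgi : iIndepFun g μ)
    (hYg : IndepFun (fun ω i => Y i ω) (fun ω i => g i ω) μ) {D : Set (E × F)}
    (hD : MeasurableSet D) :
    μ {ω | ∀ i, (Y i ω, g i ω) ∈ D} =
      ∫⁻ ω, ⨅ m : ℕ, ∏ i ∈ Finset.range m, ν (Prod.mk (Y i ω) ⁻¹' D) ∂μ := by
  have hν : IsProbabilityMeasure ν := hlaw 0 ▸ Measure.isProbabilityMeasure_map (hg 0).aemeasurable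
  have hYm : Measurable fun ω i => Y i ω := measurable_pi_iff.2 hY
  have hgm : Measurable fun ω i => g i ω := measurable_pi_iff.2 hg
  let S : Set ((ℕ → E) × (ℕ → F)) := {p | ∀ i, (p.1 i, p.2 i) ∈ D}
  have hS : MeasurableSet S := by
    have : S = ⋂ i, (fun p : (ℕ → E) × (ℕ → F) => (p.1 i, p.2 i)) ⁻¹' D := by
      ext p; simp [S]
    rw [this]
    exact MeasurableSet.iInter fun i => hD.preimage (by fun_prop)
  -- For a frozen pattern `y`, independence of the marks gives each finite product, and continuity
  -- from above gives the infimum.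
  have hfib : ∀ y : ℕ → E, μ.map (fun ω i => g i ω) (Prod.mk y ⁻¹' S) =
      ⨅ m : ℕ, ∏ i ∈ Finset.range m, ν (Prod.mk (y i) ⁻¹' D) := by
    intro y
    have hDi : ∀ i, MeasurableSet (Prod.mk (y i) ⁻¹' D) := fun i => measurable_prodMk_left hD
    rw [Measure.map_apply hgm (measurable_prodMk_left hS)]
    have h1 : (fun ω i => g i ω) ⁻¹' (Prod.mk y ⁻¹' S) =
        ⋂ m : ℕ, ⋂ i ∈ Finset.range m, g i ⁻¹' (Prod.mk (y i) ⁻¹' D) := by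
      ext ω
      simp only [Set.mem_preimage, Set.mem_iInter, Finset.mem_range]
      exact ⟨fun h m i _ => h i, fun h i => h (i + 1) i (Nat.lt_succ_self i)⟩
    rw [h1, Antitone.measure_iInter]
    · refine iInf_congr fun m => ?_
      rw [hgi.measure_inter_preimage_eq_mul _ fun i _ => hDi i]
      refine Finset.prod_congr rfl fun i _ => ?_
      rw [← hlaw i, Measure.map_apply (hg i) (hDi i)]
    · intro a b hab
      exact Set.biInter_subset_biInter_left fun i hi =>
        Finset.mem_range.2 ((Finset.mem_range.1 hi).trans_le hab)
    · exact fun m => (Finset.measurableSet_biInter _ fun i _ => hg i (hDi i)).nullMeasurableSet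
    · exact ⟨0, measure_ne_top _ _⟩
  -- Independence of the two whole sequences makes their joint law a product, which permits freezing
  -- the pattern.
  have hmap := (indepFun_iff_map_prod_eq_prod_map_map hYm.aemeasurable hgm.aemeasurable).1 hYg
  have := Measure.isProbabilityMeasure_map (μ := μ) hgm.aemeasurable
  calc μ {ω | ∀ i, (Y i ω, g i ω) ∈ D}
      = μ.map (fun ω => ((fun i => Y i ω), (fun i => g i ω))) S := by
        rw [Measure.map_apply (hYm.prodMk hgm) hS]; rfl
    _ = ∫⁻ y, μ.map (fun ω i => g i ω) (Prod.mk y ⁻¹' S) ∂(μ.map fun ω i => Y i ω) := by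
        rw [hmap, Measure.prod_apply hS]
    _ = _ := by
        rw [lintegral_map (measurable_measure_prodMk_left hS) hYm]
        exact lintegral_congr fun ω => hfib _

end Marking

/-! ### The strongest eavesdropper and the secrecy probability. -/

section Eavesdroppers

variable {Ω : Type*}

lemma active_eq (Y : ℕ → Ω → Plane) (r : ℝ) : active Y r = {ω | ∀ i, r ≤ ‖Y i ω‖} := by
  ext ω
  simp [active, count, Set.eq_empty_iff_forall_notMem]

lemma gain_strongest {α : ℝ} {Y : ℕ → Ω → Plane} {g : ℕ → Ω → ℝ} {ω : Ω}
    (h : ∃ i, ∀ j, gain α Y g ω j ≤ gain α Y g ω i) (j : ℕ) :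
    gain α Y g ω j ≤ gain α Y g ω (strongest α Y g ω) :=
  Classical.epsilon_spec h j

/-- A maximal gain must be assumed to exist, since otherwise `strongest` is an arbitrary index and
bounds nothing. -/
lemma snrS_le_iff {α Pt σS βe : ℝ} (hPt : 0 < Pt) (hσS : 0 < σS) {Y : ℕ → Ω → Plane}
    {g : ℕ → Ω → ℝ} {ω : Ω} (h : ∃ i, ∀ j, gain α Y g ω j ≤ gain α Y g ω i) :
    snrS α Pt σS Y g ω ≤ βe ↔ ∀ i, gain α Y g ω i ≤ βe * σS ^ 2 / Pt := by
  have h1 : snrS α Pt σS Y g ω ≤ βe ↔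
      gain α Y g ω (strongest α Y g ω) ≤ βe * σS ^ 2 / Pt := by
    rw [snrS, div_le_iff₀ (by positivity), le_div_iff₀ hPt, mul_comm]
  rw [h1]
  exact ⟨fun h2 i => (gain_strongest h i).trans h2, fun h2 => h2 _⟩

/-- A sequence with finitely many terms above every positive level and a positive term attains its
maximum. -/
lemma exists_forall_le_of_finite {u : ℕ → ℝ} (h0 : 0 < u 0)
    (hfin : ∀ n : ℕ, {i | 1 / ((n : ℝ) + 1) < u i}.Finite) : ∃ i, ∀ j, u j ≤ u i := by
  obtain ⟨n, hn⟩ := exists_nat_one_div_lt h0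
  obtain ⟨i, hi, hmax⟩ := Set.exists_max_image _ u (hfin n) ⟨0, hn⟩
  refine ⟨i, fun j => ?_⟩
  by_cases hj : 1 / ((n : ℝ) + 1) < u j
  · exact hmax j hj
  · exact (not_lt.1 hj).trans (le_of_lt hi)

variable [MeasurableSpace Ω] {μ : Measure Ω} {Y : ℕ → Ω → Plane} {g : ℕ → Ω → ℝ} {lam α : ℝ}

lemma measurableSet_active (hY : ∀ i, Measurable (Y i)) (r : ℝ) :
    MeasurableSet (active Y r) := by
  rw [active_eq, Set.ofPred_forall]
  exact MeasurableSet.iInter fun i => measurableSet_le measurable_const (hY i).norm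

lemma volume_real_ball {r : ℝ} (hr : 0 ≤ r) :
    (volume : Measure Plane).real (Metric.ball 0 r) = Real.pi * r ^ 2 := by
  rw [Measure.real, EuclideanSpace.volume_ball_fin_two, ENNReal.toReal_mul, ENNReal.toReal_pow,
    ENNReal.toReal_ofReal hr, ENNReal.toReal_ofReal Real.pi_pos.le, mul_comm]

lemma IsPoissonPointProcess.measure_active (hY : IsPoissonPointProcess Y lam μ) {r : ℝ}
    (hr : 0 ≤ r) :
    μ (active Y r) = ENNReal.ofReal (Real.exp (-(lam * (Real.pi * r ^ 2)))) := by
  have h := hY.count_law (Metric.ball 0 r) Metric.isOpen_ball.measurableSet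
    measure_ball_lt_top.ne 0
  rw [volume_real_ball hr] at h
  simpa [active] using h

variable [IsProbabilityMeasure μ] (hY : IsPoissonPointProcess Y lam μ) (hlam : 0 < lam) (hα : 0 < α)
  (hg_meas : ∀ i, Measurable (g i)) (hg_law : ∀ i, μ.map (g i) = expMeasure 1)
  (hYg_indep : IndepFun (fun ω i => Y i ω) (fun ω i => g i ω) μ)

include hY hlam

/-- The intensity has no atoms. The origin must be avoided because `0 ^ (-α) = 0` makes the gain
there vanish. -/
lemma IsPoissonPointProcess.ae_ne_zero (i : ℕ) : ∀ᵐ ω ∂μ, Y i ω ≠ 0 := by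
  have h : Measure.sum (fun i => μ.map (Y i)) {0} = 0 := by
    rw [hY.sum_map hlam, Measure.smul_apply, measure_singleton, smul_zero]
  have h2 := le_antisymm ((Measure.le_sum (fun i => μ.map (Y i)) i {0}).trans h.le) zero_le
  rw [Measure.map_apply (hY.measurable i) (measurableSet_singleton _)] at h2
  filter_upwards [compl_mem_ae_iff.2 h2] with ω hω using hω

include hα hg_meas hg_law hYg_indep

/-- Borel–Cantelli: by Campbell's formula the probabilities of the events `s < gain` sum to at most
`λ ∫ exp(-s ‖y‖ ^ α) dy`, which is finite. -/
lemma IsPoissonPointProcess.ae_finite_lt_gain {s : ℝ} (hs : 0 < s) :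
    ∀ᵐ ω ∂μ, {i | s < gain α Y g ω i}.Finite := by
  have := isProbabilityMeasure_expMeasure one_pos
  let D : Set (Plane × ℝ) := {p | s < p.2 * ‖p.1‖ ^ (-α)}
  have hD : MeasurableSet D := measurableSet_lt measurable_const (by fun_prop)
  have hle : ∀ y : Plane, expMeasure 1 (Prod.mk y ⁻¹' D) ≤
      ENNReal.ofReal (Real.exp (-(s * ‖y‖ ^ α))) := by
    intro y
    rw [← expMeasure_one_Ioi (by positivity)]
    refine measure_mono fun t ht => ?_
    change s < t * ‖y‖ ^ (-α) at ht
    rcases (norm_nonneg y).eq_or_lt with h | h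
    · rw [← h, Real.zero_rpow (neg_ne_zero.2 hα.ne'), mul_zero] at ht
      exact absurd ht hs.not_gt
    · rw [Real.rpow_neg h.le, ← div_eq_mul_inv, lt_div_iff₀ (by positivity)] at ht
      exact ht
  have hmeas : Measurable fun y : Plane => ENNReal.ofReal (Real.exp (-(s * ‖y‖ ^ α))) := by
    fun_prop
  have hi : ∀ i, μ {ω | s < gain α Y g ω i} ≤
      ∫⁻ y, ENNReal.ofReal (Real.exp (-(s * ‖y‖ ^ α))) ∂(μ.map (Y i)) := by
    intro i
    have hind : IndepFun (Y i) (g i) μ :=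
      hYg_indep.comp (measurable_pi_apply i) (measurable_pi_apply i)
    have hmap := (indepFun_iff_map_prod_eq_prod_map_map (hY.measurable i).aemeasurable
      (hg_meas i).aemeasurable).1 hind
    have h1 : μ {ω | s < gain α Y g ω i} = μ.map (fun ω => (Y i ω, g i ω)) D := by
      rw [Measure.map_apply ((hY.measurable i).prodMk (hg_meas i)) hD]
      rfl
    rw [h1, hmap, hg_law, Measure.prod_apply hD]
    exact lintegral_mono hle
  have hint : ∫⁻ y : Plane, ENNReal.ofReal (Real.exp (-(s * ‖y‖ ^ α))) ≠ ⊤ := by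
    have h := lintegral_compl_ball_exp_neg_rpow hα hs le_rfl
    rw [Metric.ball_zero, Set.compl_empty, Measure.restrict_univ] at h
    rw [h]
    exact ENNReal.ofReal_ne_top
  have hsum : ∑' i, μ {ω | s < gain α Y g ω i} ≠ ⊤ := by
    refine ne_top_of_le_ne_top ?_ (ENNReal.tsum_le_tsum hi)
    rw [← lintegral_sum_measure, hY.sum_map hlam, lintegral_smul_measure]
    exact ENNReal.mul_ne_top ENNReal.ofReal_ne_top hint
  have h0 := measure_setOfPred_frequently_eq_zero hsum
  filter_upwards [compl_mem_ae_iff.2 h0] with ω hω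
  by_contra hinf
  exact hω (Nat.frequently_atTop_iff_infinite.2 hinf)

/-- Almost surely there is a strongest eavesdropper. -/
lemma IsPoissonPointProcess.ae_exists_strongest :
    ∀ᵐ ω ∂μ, ∃ i, ∀ j, gain α Y g ω j ≤ gain α Y g ω i := by
  have hpos : ∀ᵐ ω ∂μ, 0 < g 0 ω := by
    have h : μ.map (g 0) (Set.Iic 0) = 0 := by
      rw [hg_law, expMeasure_one_Iic le_rfl]
      simp
    rw [Measure.map_apply (hg_meas 0) measurableSet_Iic] at h
    filter_upwards [compl_mem_ae_iff.2 h] with ω hω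
    simpa using hω
  have hfin : ∀ᵐ ω ∂μ, ∀ n : ℕ, {i | 1 / ((n : ℝ) + 1) < gain α Y g ω i}.Finite :=
    ae_all_iff.2 fun n => hY.ae_finite_lt_gain hlam hα hg_meas hg_law hYg_indep (by positivity)
  filter_upwards [hpos, hfin, hY.ae_ne_zero hlam 0] with ω h1 h2 h3
  have := norm_pos_iff.2 h3
  exact exists_forall_le_of_finite (mul_pos h1 (Real.rpow_pos_of_pos this _)) h2

/-- Marking and the generating functional reduce this to integrating `1 - f`, which is `1` inside
the disc and `exp(-T ‖y‖ ^ α)` outside it. -/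
lemma IsPoissonPointProcess.measure_active_inter_gain_le (hg_indep : iIndepFun g μ) {r T : ℝ}
    (hr : 0 ≤ r) (hT : 0 < T) :
    μ (active Y r ∩ {ω | ∀ i, gain α Y g ω i ≤ T}) =
      ENNReal.ofReal (Real.exp (-(lam * (Real.pi * r ^ 2 +
        2 * Real.pi / α * T ^ (-(2 / α)) * upperGamma (2 / α) (T * r ^ α))))) := by
  have := isProbabilityMeasure_expMeasure one_pos
  let D : Set (Plane × ℝ) := {p | r ≤ ‖p.1‖} ∩ {p | p.2 * ‖p.1‖ ^ (-α) ≤ T}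
  have hD : MeasurableSet D :=
    (measurableSet_le measurable_const (by fun_prop)).inter
      (measurableSet_le (by fun_prop) measurable_const)
  have hset : active Y r ∩ {ω | ∀ i, gain α Y g ω i ≤ T} = {ω | ∀ i, (Y i ω, g i ω) ∈ D} := by
    ext ω
    rw [active_eq]
    exact forall_and.symm
  have hball : ∀ y ∈ Metric.ball (0 : Plane) r, 1 - expMeasure 1 (Prod.mk y ⁻¹' D) = 1 := by
    intro y hy
    have : Prod.mk y ⁻¹' D = ∅ := by
      refine Set.eq_empty_of_forall_notMem fun t ht => ?_
      exact (mem_ball_zero_iff.1 hy).not_ge ht.1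
    rw [this, measure_empty, tsub_zero]
  -- At `y = 0`, which lies outside the ball only if `r = 0`, the convention `0 ^ (-α) = 0` breaks
  -- the formula; this point is later dropped as a null set.
  have hout : ∀ y ∈ (Metric.ball (0 : Plane) r)ᶜ, y ≠ 0 → 1 - expMeasure 1 (Prod.mk y ⁻¹' D) =
      ENNReal.ofReal (Real.exp (-(T * ‖y‖ ^ α))) := by
    intro y hy h0
    have h := norm_pos_iff.2 h0
    have hry : r ≤ ‖y‖ := by simpa using hy
    have : (Prod.mk y ⁻¹' D)ᶜ = Set.Ioi (T * ‖y‖ ^ α) := by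
      ext t
      have : (Prod.mk y ⁻¹' D) = {t | r ≤ ‖y‖ ∧ t * ‖y‖ ^ (-α) ≤ T} := rfl
      rw [this]
      simp only [hry, true_and, Set.mem_compl_iff, Set.mem_ofPred_eq, not_le, Set.mem_Ioi]
      rw [Real.rpow_neg h.le, ← div_eq_mul_inv, lt_div_iff₀ (by positivity)]
    rw [← prob_compl_eq_one_sub (measurable_prodMk_left hD), this,
      expMeasure_one_Ioi (by positivity)]
  have hJ : 0 ≤ 2 * Real.pi / α * T ^ (-(2 / α)) * upperGamma (2 / α) (T * r ^ α) := by
    refine mul_nonneg (by positivity) (setIntegral_nonneg measurableSet_Ioi fun t ht => ?_)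
    have : 0 < t := lt_of_le_of_lt (by positivity) ht
    positivity
  have hval : ∫⁻ y, (1 - expMeasure 1 (Prod.mk y ⁻¹' D)) = ENNReal.ofReal (Real.pi * r ^ 2 +
      2 * Real.pi / α * T ^ (-(2 / α)) * upperGamma (2 / α) (T * r ^ α)) := by
    rw [← lintegral_add_compl _ (Metric.isOpen_ball (x := (0 : Plane)) (ε := r)).measurableSet,
      setLIntegral_congr_fun Metric.isOpen_ball.measurableSet hball,
      ENNReal.ofReal_add (by positivity) hJ, ← volume_real_ball hr, Measure.real,
      ENNReal.ofReal_toReal measure_ball_lt_top.ne, setLIntegral_one,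
      ← lintegral_compl_ball_exp_neg_rpow hα hT hr]
    congr 1
    refine lintegral_congr_ae ?_
    filter_upwards [ae_restrict_mem Metric.isOpen_ball.measurableSet.compl,
      ae_restrict_of_ae (Measure.ae_ne volume (0 : Plane))] with y h1 h2
    exact hout y h1 h2
  rw [hset, measure_forall_mem_marked hY.measurable hg_meas hg_law hg_indep hYg_indep hD,
    hY.lintegral_iInf_prod hlam (measurable_measure_prodMk_left hD) (fun y => prob_le_one)
      (by rw [hval]; exact ENNReal.ofReal_ne_top), hval,
    ENNReal.toReal_ofReal (add_nonneg (by positivity) hJ)]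

lemma IsPoissonPointProcess.Psec_eq (hg_indep : iIndepFun g μ) {Pt σS βe r : ℝ} (hPt : 0 < Pt)
    (hσS : 0 < σS) (hβe : 0 < βe) (hr : 0 ≤ r) :
    Psec μ α Pt σS βe Y g r = Real.exp (-(lam * (2 * Real.pi / α *
      (βe * σS ^ 2 / Pt) ^ (-(2 / α)) *
        upperGamma (2 / α) (βe * σS ^ 2 / Pt * r ^ α)))) := by
  have hT : 0 < βe * σS ^ 2 / Pt := by positivity
  have hae : (active Y r ∩ {ω | snrS α Pt σS Y g ω ≤ βe} : Set Ω) =ᵐ[μ]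
      (active Y r ∩ {ω | ∀ i, gain α Y g ω i ≤ βe * σS ^ 2 / Pt} : Set Ω) := by
    refine (ae_eq_refl _).inter ?_
    filter_upwards [hY.ae_exists_strongest hlam hα hg_meas hg_law hYg_indep] with ω hω
    exact propext (snrS_le_iff hPt hσS hω)
  rw [Psec, Measure.real, cond_apply (measurableSet_active hY.measurable r), measure_congr hae,
    hY.measure_active_inter_gain_le hlam hα hg_meas hg_law hYg_indep hg_indep hr hT,
    hY.measure_active hr, ENNReal.toReal_mul, ENNReal.toReal_inv,
    ENNReal.toReal_ofReal (Real.exp_pos _).le, ENNReal.toReal_ofReal (Real.exp_pos _).le,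
    ← Real.exp_neg, ← Real.exp_add]
  congr 1
  ring

end Eavesdroppers

/-! ### The coverage probability. -/

section Coverage

variable {Ω : Type*} [MeasurableSpace Ω] {μ : Measure Ω}
  {Y : ℕ → Ω → Plane} {g : ℕ → Ω → ℝ} {h : Ω → ℝ} {lam α Pt σP d βt r : ℝ}

lemma IsPoissonPointProcess.Pcov_eq (hY : IsPoissonPointProcess Y lam μ) (hPt : 0 < Pt)
    (hσP : 0 < σP) (hd : 0 < d) (hβt : 0 < βt) (hh_meas : Measurable h)
    (hh_law : μ.map h = expMeasure 1)
    (hh_indep : IndepFun h (fun ω => ((fun i => Y i ω), (fun i => g i ω))) μ) (hr : 0 ≤ r) :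
    Pcov μ α Pt σP d βt Y h r = Real.exp (-(βt * σP ^ 2 / (Pt * d ^ (-α)))) *
      Real.exp (-(lam * (Real.pi * r ^ 2))) := by
  have hset : {ω | βt ≤ snrP α Pt σP d h ω} = h ⁻¹' Set.Ici (βt * σP ^ 2 / (Pt * d ^ (-α))) := by
    ext ω
    simp only [snrP, Set.mem_ofPred_eq, Set.mem_preimage, Set.mem_Ici]
    rw [le_div_iff₀ (by positivity), div_le_iff₀ (by positivity)]
    ring_nf
  -- Activity is an event about the pair (pattern, marks), the form in which the independence of `h`
  -- is given.
  let S : Set ((ℕ → Plane) × (ℕ → ℝ)) := {p | ∀ i, r ≤ ‖p.1 i‖}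
  have hS : MeasurableSet S := by
    have : S = ⋂ i, {p | r ≤ ‖p.1 i‖} := by ext p; simp [S]
    rw [this]
    exact MeasurableSet.iInter fun i => measurableSet_le measurable_const (by fun_prop)
  have hact : active Y r = (fun ω => ((fun i => Y i ω), (fun i => g i ω))) ⁻¹' S := active_eq Y r
  have hlaw : μ (h ⁻¹' Set.Ici (βt * σP ^ 2 / (Pt * d ^ (-α)))) =
      ENNReal.ofReal (Real.exp (-(βt * σP ^ 2 / (Pt * d ^ (-α))))) := by
    rw [← Measure.map_apply hh_meas measurableSet_Ici, hh_law, expMeasure_one_Ici (by positivity)]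
  rw [Pcov, hset, Measure.real, hact,
    hh_indep.measure_inter_preimage_eq_mul _ _ measurableSet_Ici hS, ← hact, hlaw,
    hY.measure_active hr, ENNReal.toReal_mul, ENNReal.toReal_ofReal (Real.exp_pos _).le,
    ENNReal.toReal_ofReal (Real.exp_pos _).le]

end Coverage

/-! ### Monotonicity of the incomplete gamma function and the optimization. -/

section Optimization

lemma upperGamma_integrableOn {s : ℝ} (hs : 0 < s) :
    IntegrableOn (fun t : ℝ => t ^ (s - 1) * Real.exp (-t)) (Set.Ioi 0) := by
  simpa only [mul_comm] using Real.GammaIntegral_convergent hs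

lemma upperGamma_zero {s : ℝ} (hs : 0 < s) : upperGamma s 0 = Real.Gamma s := by
  rw [upperGamma, Real.Gamma_eq_integral hs]
  simp only [mul_comm]

lemma upperGamma_add_integral {s a b : ℝ} (hs : 0 < s) (ha : 0 ≤ a) (hab : a ≤ b) :
    (∫ t in Set.Ioc a b, t ^ (s - 1) * Real.exp (-t)) + upperGamma s b = upperGamma s a := by
  have hint := upperGamma_integrableOn hs
  rw [upperGamma, upperGamma, ← setIntegral_union (Set.Ioc_disjoint_Ioi le_rfl) measurableSet_Ioi
    (hint.mono_set fun t ht => ha.trans_lt ht.1)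
    (hint.mono_set (Set.Ioi_subset_Ioi (ha.trans hab))), Set.Ioc_union_Ioi_eq_Ioi hab]

lemma strictAntiOn_upperGamma {s : ℝ} (hs : 0 < s) :
    StrictAntiOn (upperGamma s) (Set.Ici 0) := by
  intro a ha b hb hab
  rw [← upperGamma_add_integral hs ha hab.le, lt_add_iff_pos_left]
  have hpos : ∀ t ∈ Set.Ioc a b, 0 < t ^ (s - 1) * Real.exp (-t) := fun t ht => by
    have : 0 < t := lt_of_le_of_lt ha ht.1
    positivity
  rw [setIntegral_pos_iff_support_of_nonneg_ae
    ((ae_restrict_mem measurableSet_Ioc).mono fun t ht => (hpos t ht).le)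
    ((upperGamma_integrableOn hs).mono_set fun t ht => lt_of_le_of_lt ha ht.1),
    Set.inter_eq_right.2 fun t ht => Function.mem_support.2 (hpos t ht).ne', Real.volume_Ioc]
  simpa using hab

lemma continuousOn_upperGamma {s : ℝ} (hs : 0 < s) :
    ContinuousOn (upperGamma s) (Set.Ici 0) := by
  have hint : ∀ a b, 0 ≤ a → 0 ≤ b →
      IntervalIntegrable (fun t : ℝ => t ^ (s - 1) * Real.exp (-t)) volume a b := by
    intro a b ha hb
    rw [intervalIntegrable_iff]
    exact (upperGamma_integrableOn hs).mono_set fun t ht => lt_of_le_of_lt (le_min ha hb) ht.1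
  have hc : ContinuousOn (fun x => Real.Gamma s -
      ∫ t in (0 : ℝ)..x, t ^ (s - 1) * Real.exp (-t)) (Set.Ici 0) := by
    intro x hx
    -- The endpoint `x + 1` makes the interval a neighbourhood of `x` within `[0, ∞)`. Integrability
    -- is used because the integrand may blow up at `0`.
    have h := intervalIntegral.continuousOn_primitive_interval
      (μ := volume) (a := (0 : ℝ)) (b := x + 1)
      (f := fun t : ℝ => t ^ (s - 1) * Real.exp (-t)) ?_
    · have hx0 : (0 : ℝ) ≤ x := hx
      rw [Set.uIcc_of_le (by linarith)] at h
      have h2 := (continuousWithinAt_const (b := Real.Gamma s)).sub (h x ⟨hx0, by linarith⟩)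
      refine h2.mono_of_mem_nhdsWithin ?_
      rw [mem_nhdsWithin]
      exact ⟨Set.Iio (x + 1), isOpen_Iio, by simp, fun y hy => ⟨hy.2, hy.1.le⟩⟩
    · have := hint 0 (x + 1) le_rfl (add_nonneg hx zero_le_one)
      exact (intervalIntegrable_iff' enorm_ne_top).1 this
  refine hc.congr fun x hx => ?_
  have := upperGamma_add_integral hs le_rfl hx
  rw [upperGamma_zero hs, ← intervalIntegral.integral_of_le hx] at this
  exact eq_sub_of_add_eq' this

lemma tendsto_upperGamma {s : ℝ} (hs : 0 < s) :
    Filter.Tendsto (upperGamma s) Filter.atTop (nhds 0) := by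
  have h := intervalIntegral_tendsto_integral_Ioi 0 (upperGamma_integrableOn hs) Filter.tendsto_id
  have h2 := h.const_sub (upperGamma s 0)
  rw [← upperGamma, sub_self] at h2
  refine h2.congr' ?_
  filter_upwards [Filter.eventually_ge_atTop 0] with x hx
  rw [← upperGamma_add_integral hs le_rfl hx, id, intervalIntegral.integral_of_le hx]
  ring

/-- Intermediate values between `Γ(s)` at `0` and the limit `0` at infinity, followed by solving `T
r ^ α = x`. -/
lemma exists_upperGamma_rpow_eq {s α T c : ℝ} (hs : 0 < s) (hα : 0 < α) (hT : 0 < T)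
    (hc0 : 0 < c) (hc : c ≤ Real.Gamma s) : ∃ r, 0 ≤ r ∧ upperGamma s (T * r ^ α) = c := by
  obtain ⟨b, hb, hb0⟩ := (((tendsto_upperGamma hs).eventually (gt_mem_nhds hc0)).and
    (Filter.eventually_ge_atTop 0)).exists
  obtain ⟨x, hx, hxc⟩ := intermediate_value_Icc' hb0
    ((continuousOn_upperGamma hs).mono Set.Icc_subset_Ici_self)
    ⟨hb.le, by rwa [upperGamma_zero hs]⟩
  refine ⟨(x / T) ^ α⁻¹, Real.rpow_nonneg (div_nonneg hx.1 hT.le) _, ?_⟩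
  rw [Real.rpow_inv_rpow (div_nonneg hx.1 hT.le) hα.ne', mul_div_cancel₀ _ hT.ne', hxc]

lemma strictAntiOn_upperGamma_rpow {s α T : ℝ} (hs : 0 < s) (hα : 0 < α) (hT : 0 < T) :
    StrictAntiOn (fun r => upperGamma s (T * r ^ α)) (Set.Ici 0) := by
  intro a ha b hb hab
  have ha' : (0 : ℝ) ≤ a := ha
  have hb' : (0 : ℝ) ≤ b := hb
  exact strictAntiOn_upperGamma hs (Set.mem_Ici.2 (by positivity)) (Set.mem_Ici.2 (by positivity))
    (mul_lt_mul_of_pos_left (Real.rpow_lt_rpow ha hab hα) hT)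

/-- The maximizer of a strictly decreasing objective over `[0, ∞)`, under a constraint
`G r ≤ c` with `G` strictly decreasing. -/
lemma isOptimalRadius_iff {P S G : ℝ → ℝ} {ε c r₀ r : ℝ} (hP : StrictAntiOn P (Set.Ici 0))
    (hG : StrictAntiOn G (Set.Ici 0)) (hS : ∀ r, 0 ≤ r → (ε ≤ S r ↔ G r ≤ c)) (hr₀ : 0 ≤ r₀)
    (hr₀c : G r₀ = min c (G 0)) : IsOptimalRadius P S ε r ↔ r = r₀ := by
  -- The admissible set is `[r₀, ∞)`. If `c ≥ G 0`, the minimum forces `G r₀ = G 0`, so `r₀ = 0` and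
  -- every radius is admissible.
  have hadm : ∀ r', r' ∈ {r' : ℝ | 0 ≤ r' ∧ ε ≤ S r'} ↔ r₀ ≤ r' := by
    intro r'
    refine ⟨fun ⟨h0, h1⟩ => ?_, fun h => ?_⟩
    · rw [hS r' h0] at h1
      refine (hG.le_iff_ge h0 hr₀).1 (hr₀c ▸ le_min h1 ?_)
      exact hG.antitoneOn (Set.mem_Ici.2 le_rfl) h0 h0
    · have h0 := hr₀.trans h
      refine ⟨h0, (hS r' h0).2 ((hG.antitoneOn hr₀ h0 h).trans ?_)⟩
      exact hr₀c ▸ min_le_left _ _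
  constructor
  · rintro ⟨h1, h2⟩
    have hr := (hadm r).1 h1
    have := h2 ((hadm r₀).2 le_rfl)
    exact le_antisymm ((hP.le_iff_ge hr₀ (hr₀.trans hr)).1 this) hr
  · rintro rfl
    refine ⟨(hadm r).2 le_rfl, fun r' hr' => ?_⟩
    have := (hadm r').1 hr'
    exact hP.antitoneOn hr₀ (hr₀.trans this) this

end Optimization

end GuardZone

theorem lemma2 {Ω : Type*} [MeasurableSpace Ω] (μ : Measure Ω) [IsProbabilityMeasure μ]
    (α Pt σP σS d βt βe lam ε : ℝ)
    (hα : 2 < α) (hPt : 0 < Pt) (hσP : 0 < σP) (hσS : 0 < σS) (hd : 0 < d)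
    (hβt : 0 < βt) (hβe : 0 < βe) (hlam : 0 < lam) (hε₀ : 0 < ε) (hε₁ : ε < 1)
    -- eavesdroppers, fading on the links to them, fading on the link to the primary receiver
    (Y : ℕ → Ω → GuardZone.Plane) (g : ℕ → Ω → ℝ) (h : Ω → ℝ)
    (hY : GuardZone.IsPoissonPointProcess Y lam μ)
    (hg_meas : ∀ i, Measurable (g i)) (hg_law : ∀ i, μ.map (g i) = expMeasure 1)
    (hh_meas : Measurable h) (hh_law : μ.map h = expMeasure 1)
    -- the `g i`, the point process and `h` are independent
    (hg_indep : iIndepFun g μ)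
    (hYg_indep : IndepFun (fun ω i => Y i ω) (fun ω i => g i ω) μ)
    (hh_indep : IndepFun h (fun ω => ((fun i => Y i ω), (fun i => g i ω))) μ) :
    (∃! r : ℝ, GuardZone.IsOptimalRadius (GuardZone.Pcov μ α Pt σP d βt Y h)
      (GuardZone.Psec μ α Pt σS βe Y g) ε r) ∧
    ∀ r : ℝ, 0 ≤ r →
      (GuardZone.IsOptimalRadius (GuardZone.Pcov μ α Pt σP d βt Y h)
        (GuardZone.Psec μ α Pt σS βe Y g) ε r ↔
      GuardZone.upperGamma (2 / α) (r ^ α * βe * σS ^ 2 / Pt) =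
        min (α * Real.log (1 / ε) / (2 * Real.pi * lam * (Pt / (σS ^ 2 * βe)) ^ (2 / α)))
          (Real.Gamma (2 / α))) := by
  have hα0 : 0 < α := by linarith
  have hs : 0 < 2 / α := by positivity
  have hT : 0 < βe * σS ^ 2 / Pt := by positivity
  have hK : 0 < 2 * Real.pi * lam * (Pt / (σS ^ 2 * βe)) ^ (2 / α) := by positivity
  -- Positivity of the target value, from `ε < 1`, is what lets the incomplete gamma function attain
  -- it at a finite radius.
  have hlog : 0 < Real.log (1 / ε) := Real.log_pos (by rw [lt_div_iff₀ hε₀]; linarith)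
  have hTs : (βe * σS ^ 2 / Pt) ^ (-(2 / α)) = (Pt / (σS ^ 2 * βe)) ^ (2 / α) := by
    rw [Real.rpow_neg hT.le, ← Real.inv_rpow hT.le, inv_div, mul_comm βe]
  have harg : ∀ r : ℝ, r ^ α * βe * σS ^ 2 / Pt = βe * σS ^ 2 / Pt * r ^ α := fun r => by ring
  have hG := GuardZone.strictAntiOn_upperGamma_rpow hs hα0 hT
  have hG0 : GuardZone.upperGamma (2 / α) (βe * σS ^ 2 / Pt * 0 ^ α) = Real.Gamma (2 / α) := by
    rw [Real.zero_rpow hα0.ne', mul_zero, GuardZone.upperGamma_zero hs]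
  have hP : StrictAntiOn (GuardZone.Pcov μ α Pt σP d βt Y h) (Set.Ici 0) := by
    intro a ha b hb hab
    rw [hY.Pcov_eq hPt hσP hd hβt hh_meas hh_law hh_indep ha,
      hY.Pcov_eq hPt hσP hd hβt hh_meas hh_law hh_indep hb]
    refine mul_lt_mul_of_pos_left (Real.exp_lt_exp.2 (neg_lt_neg ?_)) (Real.exp_pos _)
    exact mul_lt_mul_of_pos_left (mul_lt_mul_of_pos_left (pow_lt_pow_left₀ hab ha two_ne_zero)
      Real.pi_pos) hlam
  have hS : ∀ r, 0 ≤ r → (ε ≤ GuardZone.Psec μ α Pt σS βe Y g r ↔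
      GuardZone.upperGamma (2 / α) (βe * σS ^ 2 / Pt * r ^ α) ≤
        α * Real.log (1 / ε) / (2 * Real.pi * lam * (Pt / (σS ^ 2 * βe)) ^ (2 / α))) := by
    intro r hr
    -- Taking logarithms turns the secrecy constraint into a linear bound on the incomplete gamma
    -- value.
    rw [hY.Psec_eq hlam hα0 hg_meas hg_law hYg_indep hg_indep hPt hσS hβe hr, hTs,
      ← Real.log_le_iff_le_exp hε₀, le_div_iff₀ hK, one_div, Real.log_inv, le_neg,
      mul_neg, ← mul_le_mul_iff_right₀ hα0, mul_neg]
    exact Iff.of_eq (congrArg (· ≤ _) (by field_simp))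
  obtain ⟨r₀, hr₀, hr₀c⟩ := GuardZone.exists_upperGamma_rpow_eq hs hα0 hT
    (lt_min (div_pos (mul_pos hα0 hlog) hK) (Real.Gamma_pos_of_pos hs)) (min_le_right _ _)
  have hopt := fun r => GuardZone.isOptimalRadius_iff (r := r) hP hG hS hr₀
    (by simpa only [hG0] using hr₀c)
  refine ⟨⟨r₀, (hopt r₀).2 rfl, fun r hr => (hopt r).1 hr⟩, fun r hr => ?_⟩
  rw [hopt r, harg r, ← hr₀c]
  exact ⟨fun h => h ▸ rfl, fun h => hG.injOn hr hr₀ h⟩
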